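/- Consider two-armed bandits over a horizon of $T$ rounds. In round $t\in\{1,\dots,T\}$ a (possibly randomized) policy $\pi$ chooses an arm $a_t\in\{1,2\}$ on the basis of the past observations $a_1,r_1,\dots,a_{t-1},r_{t-1}$, and observes the reward $r_t=\mu_t(a_t)+\xi_t$, where the $\xi_t$ are independent standard Gaussian variables. For a threshold $S\in\mathbb R$, the satisficing regret of $\pi$ on the instance $\nu=(\mu_t)_{t\le T}$ is $$R_T^S(\pi;\nu)=\mathbb E_{\pi,\nu}\Big[\sum_{t=1}^T\max\{0,\,S-\mu_t(a_t)\}\Big].$$ For $\Delta>0$ and $L\ge 1$ let $\mathcal E_{L,\Delta}$ be the class of instances with exactly $L$ stationary segments (that is, $\mu_t\ne\mu_{t+1}$ for exactly $L-1$ values of $t\in\{1,\dots,T-1\}$) such that, on each segment, the mean vector $(\mu_t(1),\mu_t(2))$ is either $(S+\Delta,S-\Delta)$ or $(S-\Delta,S+\Delta)$; thus the unique arm with mean at least $S$ swaps at every change point. Theorem. There is an absolute constant $c>0$ such that for every $S\in\mathbb R$, every $0<\Delta\le\frac12$, and all integers $L\ge 2$ and $T$ with $\Delta^2T\ge 13L$,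 $$\inf_{\pi}\ \sup_{\nu\in\mathcal E_{L,\Delta}} R_T^S(\pi;\nu)\ \ge\ c\,\frac{L\log(\Delta^2T/L)}{\Delta},$$ where the infimum is over all (possibly randomized) policies. -/

import Mathlib

open MeasureTheory ProbabilityTheory
open scoped ENNReal

namespace SatisficingBandit

/-- The observations of the first `t` rounds: the pairs (action, reward). Rounds are numbered
`0, 1, 2, …`. -/
abbrev History (K t : ℕ) : Type := Fin t → Fin K × ℝ

/-- A randomized policy for `K` arms: in round `t` it draws an arm from a distribution that is a
measurable function of the observations of the rounds before `t`. -/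
structure Policy (K : ℕ) where
  /-- The conditional law of the action of round `t`, given the past. -/
  act : (t : ℕ) → Kernel (History K t) (Fin K)
  /-- It is a probability distribution. -/
  isMarkov : ∀ t, IsMarkovKernel (act t)

/-- The mean rewards of a nonstationary `K`-armed bandit: `μ t a` is the mean of arm `a` in
round `t`. With a horizon `T` only the rounds `t < T` matter. -/
abbrev Means (K : ℕ) : Type := ℕ → Fin K → ℝ

/-- The unit-variance Gaussian reward law of each arm in round `t`. -/
noncomputable def rewardKernel {K : ℕ} (μ : Means K) (t : ℕ) : Kernel (Fin K) ℝ :=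
  Kernel.ofFunOfCountable fun a => gaussianReal (μ t a) 1

/-- The conditional law of the pair (action, reward) of round `t`, given the past: the action is
drawn by the policy, and then, given the past and the action `a`, the reward is
`μ t a` plus a standard Gaussian noise. -/
noncomputable def stepKernel {K : ℕ} (π : Policy K) (μ : Means K) (t : ℕ) :
    Kernel (History K t) (Fin K × ℝ) :=
  π.act t ⊗ₖ Kernel.prodMkLeft (History K t) (rewardKernel μ t)

/-- The law of the observations of the first `t` rounds, when the policy `π` interacts with the
unit-variance Gaussian bandit whose means are `μ`. -/
noncomputable def law {K : ℕ} (π : Policy K) (μ : Means K) : (t : ℕ) → Measure (History K t)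
  | 0 => Measure.dirac Fin.elim0
  | t + 1 => (law π μ t ⊗ₘ stepKernel π μ t).map
      fun p => (Fin.snoc p.1 p.2 : History K (t + 1))

/-- The satisficing regret over the horizon `T` with threshold `S`: the expectation of the sum of
the shortfalls `max 0 (S - μ t a)`, where `a` is the arm pulled in round `t`. -/
noncomputable def regret {K : ℕ} (S : ℝ) (T : ℕ) (π : Policy K) (μ : Means K) : ℝ≥0∞ :=
  ∫⁻ h, ∑ t : Fin T, ENNReal.ofReal (max 0 (S - μ t (h t).1)) ∂(law π μ T)

open Classical in
/-- The number of stationary segments in the horizon `T ≥ 1`: one plus the number of pairs of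
consecutive rounds `j`, `j + 1` before `T` between which the mean of some arm changes. -/
noncomputable def numSegments {K : ℕ} (μ : Means K) (T : ℕ) : ℕ :=
  1 + ((Finset.range (T - 1)).filter fun j => ∃ a, μ j a ≠ μ (j + 1) a).card

/-- The class of two-armed instances with horizon `T` that have `L` stationary segments, on each
of which the mean vector is `(S + Δ, S - Δ)` or `(S - Δ, S + Δ)`. -/
def hardClass (S Δ : ℝ) (T L : ℕ) : Set (Means 2) :=
  {μ | (∀ t < T, μ t = ![S + Δ, S - Δ] ∨ μ t = ![S - Δ, S + Δ]) ∧ numSegments μ T = L}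

/-- The minimax satisficing regret over this class. -/
noncomputable def minimaxRegret (S Δ : ℝ) (T L : ℕ) : ℝ≥0∞ :=
  ⨅ π : Policy 2, ⨆ μ ∈ hardClass S Δ T L, regret S T π μ

end SatisficingBandit

namespace SatisficingBandit

/-! For a fixed policy a bad instance is built block by block, on `L - 1` blocks of `n = T / L`
rounds with one swap each. Put `x = Δ² n`. If without a swap the bad arm is pulled at least `y = log
x / (8Δ²)` times on average in the block, the swap waits until the block's end. Otherwise some
window of about `y` rounds contains few such pulls, and the swap is placed at its start: over so
short a time the policy cannot detect it, so it keeps avoiding the arm that has become good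
(`exists_flipFrom_le_sum_badProb`). Undetectability is a chi-square change of measure:
Cauchy–Schwarz bounds the squared probability of a pull after the swap by `exp (4Δ² i)` times its
probability without the swap, `i` rounds later (`sq_pull_le`). Within the window this factor is at
most `√x`. By causality later swaps leave the regret already collected unchanged, so the blocks add
up (`exists_le_sum_badProb`). -/

theorem sq_lintegral_mul_le {α : Type*} [MeasurableSpace α] (μ : Measure α) {f g : α → ℝ≥0∞}
    (hf : AEMeasurable f μ) (hg : AEMeasurable g μ) :
    (∫⁻ x, f x * g x ∂μ) ^ 2 ≤ (∫⁻ x, f x ^ 2 ∂μ) * ∫⁻ x, g x ^ 2 ∂μ := by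
  have h := ENNReal.lintegral_mul_le_Lp_mul_Lq μ Real.HolderConjugate.two_two hf hg
  simp only [Pi.mul_apply, ENNReal.rpow_ofNat] at h
  have hsq : ∀ a : ℝ≥0∞, (a ^ (1 / 2 : ℝ)) ^ 2 = a := fun a => by
    rw [← ENNReal.rpow_natCast, ← ENNReal.rpow_mul]; norm_num
  refine (pow_le_pow_left₀ zero_le h 2).trans ?_
  rw [mul_pow, hsq, hsq]

theorem sq_lintegral_le {α : Type*} [MeasurableSpace α] (μ : Measure α) [IsProbabilityMeasure μ]
    {f : α → ℝ≥0∞} (hf : AEMeasurable f μ) : (∫⁻ x, f x ∂μ) ^ 2 ≤ ∫⁻ x, f x ^ 2 ∂μ := by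
  simpa using sq_lintegral_mul_le μ hf (aemeasurable_const (b := (1 : ℝ≥0∞)))

/-- Change of measure between Gaussians: the second moment of the likelihood ratio of
`N(b, 1)` with respect to `N(a, 1)` is `exp ((b - a) ^ 2)`. -/
theorem sq_lintegral_gaussianReal_le (a b : ℝ) {f : ℝ → ℝ≥0∞} (hf : Measurable f) :
    (∫⁻ x, f x ∂gaussianReal b 1) ^ 2 ≤
      ENNReal.ofReal (Real.exp ((b - a) ^ 2)) * ∫⁻ x, f x ^ 2 ∂gaussianReal a 1 := by
  set g : ℝ → ℝ≥0∞ := fun x =>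
    ENNReal.ofReal (Real.exp (((b - a) * (2 * x - a - b)) / 2)) with hg
  have hgm : Measurable g := by fun_prop
  have h1 : ∫⁻ x, f x ∂gaussianReal b 1 = ∫⁻ x, f x * g x ∂gaussianReal a 1 := by
    rw [gaussianReal_of_var_ne_zero _ one_ne_zero, gaussianReal_of_var_ne_zero _ one_ne_zero,
      lintegral_withDensity_eq_lintegral_mul _ (measurable_gaussianPDF _ _) hf,
      lintegral_withDensity_eq_lintegral_mul (g := fun x => f x * g x) _
        (measurable_gaussianPDF _ _) (hf.mul hgm)]
    refine lintegral_congr fun x => ?_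
    simp only [Pi.mul_apply]
    rw [mul_comm (f x) (g x), ← mul_assoc]
    congr 1
    simp only [gaussianPDF, hg, gaussianPDFReal]
    rw [← ENNReal.ofReal_mul (by positivity),
      mul_assoc _ (Real.exp _) (Real.exp _), ← Real.exp_add]
    congr 3
    simp only [NNReal.coe_one]
    ring
  have h2 : ∫⁻ x, g x ^ 2 ∂gaussianReal a 1 = ENNReal.ofReal (Real.exp ((b - a) ^ 2)) := by
    rw [gaussianReal_of_var_ne_zero _ one_ne_zero,
      lintegral_withDensity_eq_lintegral_mul _ (measurable_gaussianPDF _ _) (hgm.pow_const 2)]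
    have : ∀ x, (gaussianPDF a 1 * fun x => g x ^ 2) x
        = ENNReal.ofReal (Real.exp ((b - a) ^ 2)) * gaussianPDF (2 * b - a) 1 x := fun x => by
      simp only [Pi.mul_apply, gaussianPDF, hg, gaussianPDFReal]
      rw [← ENNReal.ofReal_pow (by positivity), ← ENNReal.ofReal_mul (by positivity),
        ← ENNReal.ofReal_mul (by positivity), ← Real.exp_nat_mul, mul_left_comm,
        mul_assoc, ← Real.exp_add, ← Real.exp_add]
      congr 3
      simp only [NNReal.coe_one]
      push_cast
      ring
    simp_rw [this]
    rw [lintegral_const_mul _ (measurable_gaussianPDF _ _),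
      lintegral_gaussianPDF_eq_one _ one_ne_zero, mul_one]
  rw [h1, mul_comm, ← h2]
  exact sq_lintegral_mul_le _ hf.aemeasurable hgm.aemeasurable

/-! ### Interaction law, tensorized change of measure, pull probabilities -/

section Law

variable {K : ℕ}

instance (π : Policy K) (t : ℕ) : IsMarkovKernel (π.act t) := π.isMarkov t

instance (μ : Means K) (t : ℕ) : IsMarkovKernel (rewardKernel μ t) :=
  ⟨fun a => by
    simp only [rewardKernel, Kernel.ofFunOfCountable, Kernel.coe_mk]; infer_instance⟩

instance (π : Policy K) (μ : Means K) (t : ℕ) : IsMarkovKernel (stepKernel π μ t) := by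
  unfold stepKernel; infer_instance

theorem measurable_snoc (K t : ℕ) : Measurable fun p : History K t × (Fin K × ℝ) =>
    (Fin.snoc p.1 p.2 : History K (t + 1)) := by
  refine measurable_pi_lambda _ fun i => ?_
  refine Fin.lastCases ?_ (fun j => ?_) i
  · simpa using measurable_snd
  · simpa [Function.comp_def] using (measurable_pi_apply j).comp (measurable_fst (α := History K t))

instance (π : Policy K) (μ : Means K) (t : ℕ) : IsProbabilityMeasure (law π μ t) := by
  induction t with
  | zero => unfold law; infer_instance
  | succ t ih =>
    unfold law
    exact Measure.isProbabilityMeasure_map (measurable_snoc K t).aemeasurable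

theorem lintegral_stepKernel (π : Policy K) (μ : Means K) (t : ℕ) (h : History K t)
    {f : Fin K × ℝ → ℝ≥0∞} (hf : Measurable f) :
    ∫⁻ p, f p ∂stepKernel π μ t h =
      ∫⁻ a, ∫⁻ r, f (a, r) ∂gaussianReal (μ t a) 1 ∂π.act t h := by
  rw [stepKernel, Kernel.lintegral_compProd _ _ _ hf]
  rfl

theorem lintegral_law_succ (π : Policy K) (μ : Means K) (t : ℕ) {f : History K (t + 1) → ℝ≥0∞}
    (hf : Measurable f) :
    ∫⁻ h, f h ∂law π μ (t + 1) =
      ∫⁻ h, ∫⁻ p, f (Fin.snoc h p) ∂stepKernel π μ t h ∂law π μ t := by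
  rw [law, lintegral_map hf (measurable_snoc K t),
    Measure.lintegral_compProd (f := fun p => f (Fin.snoc p.1 p.2))
      (hf.comp (measurable_snoc K t))]

theorem sq_lintegral_stepKernel_le (π : Policy K) {μ μ' : Means K} {t : ℕ} {δ : ℝ}
    (hδ : ∀ a, |μ' t a - μ t a| ≤ δ) (h : History K t) {f : Fin K × ℝ → ℝ≥0∞}
    (hf : Measurable f) :
    (∫⁻ p, f p ∂stepKernel π μ' t h) ^ 2 ≤
      ENNReal.ofReal (Real.exp (δ ^ 2)) * ∫⁻ p, f p ^ 2 ∂stepKernel π μ t h := by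
  rw [lintegral_stepKernel π μ' t h hf, lintegral_stepKernel π μ t h (hf.pow_const 2),
    ← lintegral_const_mul _ (measurable_of_countable _)]
  refine (sq_lintegral_le _ (measurable_of_countable _).aemeasurable).trans
    (lintegral_mono fun a => ?_)
  refine (sq_lintegral_gaussianReal_le (μ t a) _ (hf.comp measurable_prodMk_left)).trans ?_
  refine mul_le_mul_left (ENNReal.ofReal_le_ofReal (Real.exp_le_exp.2 ?_)) _
  exact sq_le_sq' (neg_le_of_abs_le (hδ a)) (le_of_abs_le (hδ a))

theorem law_congr (π : Policy K) {μ μ' : Means K} {t : ℕ} (h : ∀ s < t, μ s = μ' s) :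
    law π μ t = law π μ' t := by
  induction t with
  | zero => rfl
  | succ t ih =>
    have h1 : stepKernel π μ t = stepKernel π μ' t := by
      simp only [stepKernel, rewardKernel, h t (Nat.lt_succ_self t)]
    rw [law, law, ih fun s hs => h s (by omega), h1]

/-- The bound tensorizes: the hypothesis on the past is applied to the conditional expectation of
`f`, whose square is then bounded by the one-step estimate. -/
theorem sq_lintegral_law_succ_le (π : Policy K) {μ μ' : Means K} {t : ℕ} {δ : ℝ} {C : ℝ≥0∞}
    (hδ : ∀ a, |μ' t a - μ t a| ≤ δ)
    (ih : ∀ f : History K t → ℝ≥0∞, Measurable f →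
      (∫⁻ h, f h ∂law π μ' t) ^ 2 ≤ C * ∫⁻ h, f h ^ 2 ∂law π μ t)
    {f : History K (t + 1) → ℝ≥0∞} (hf : Measurable f) :
    (∫⁻ h, f h ∂law π μ' (t + 1)) ^ 2 ≤
      C * ENNReal.ofReal (Real.exp (δ ^ 2)) * ∫⁻ h, f h ^ 2 ∂law π μ (t + 1) := by
  have hs : ∀ {g : History K (t + 1) → ℝ≥0∞}, Measurable g →
      Measurable fun p : History K t × (Fin K × ℝ) => g (Fin.snoc p.1 p.2) :=
    fun hg => hg.comp (measurable_snoc K t)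
  rw [lintegral_law_succ π μ' _ hf, lintegral_law_succ π μ _ (hf.pow_const 2)]
  refine (ih _ (hs hf).lintegral_kernel_prod_right').trans ?_
  rw [mul_assoc,
    ← lintegral_const_mul _ (hs (hf.pow_const 2)).lintegral_kernel_prod_right']
  exact mul_le_mul_right (lintegral_mono fun h =>
    sq_lintegral_stepKernel_le π hδ h ((hs hf).comp measurable_prodMk_left)) _

/-- Change of measure between two instances that agree before round `t₀`, and whose means differ
by at most `δ` afterwards. -/
theorem sq_lintegral_law_le (π : Policy K) {μ μ' : Means K} {t₀ : ℕ} {δ : ℝ}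
    (h : ∀ s < t₀, μ s = μ' s) (hδ : ∀ s a, |μ' s a - μ s a| ≤ δ) (i : ℕ)
    (f : History K (t₀ + i) → ℝ≥0∞) (hf : Measurable f) :
    (∫⁻ h, f h ∂law π μ' (t₀ + i)) ^ 2 ≤
      ENNReal.ofReal (Real.exp (δ ^ 2)) ^ i * ∫⁻ h, f h ^ 2 ∂law π μ (t₀ + i) := by
  induction i with
  | zero =>
    rw [← law_congr π (t := t₀ + 0) h, pow_zero, one_mul]
    exact sq_lintegral_le _ hf.aemeasurable
  | succ i ih =>
    rw [pow_succ (ENNReal.ofReal _)]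
    exact sq_lintegral_law_succ_le π (hδ _) ih hf

/-- The probability that arm `a` is pulled in round `t`. -/
noncomputable def pull (π : Policy K) (μ : Means K) (t : ℕ) (a : Fin K) : ℝ :=
  (∫⁻ h, π.act t h {a} ∂law π μ t).toReal

theorem measurable_act (π : Policy K) (t : ℕ) (a : Fin K) : Measurable fun h => π.act t h {a} :=
  (π.act t).measurable_coe (measurableSet_singleton a)

theorem lintegral_act_le_one (π : Policy K) (μ : Means K) (t : ℕ) (a : Fin K) :
    ∫⁻ h, π.act t h {a} ∂law π μ t ≤ 1 :=
  (lintegral_mono fun _ => prob_le_one).trans (by simp)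

theorem ofReal_pull (π : Policy K) (μ : Means K) (t : ℕ) (a : Fin K) :
    ENNReal.ofReal (pull π μ t a) = ∫⁻ h, π.act t h {a} ∂law π μ t :=
  ENNReal.ofReal_toReal ((lintegral_act_le_one π μ t a).trans_lt ENNReal.one_lt_top).ne

theorem pull_nonneg (π : Policy K) (μ : Means K) (t : ℕ) (a : Fin K) : 0 ≤ pull π μ t a :=
  ENNReal.toReal_nonneg

theorem sum_pull (π : Policy K) (μ : Means K) (t : ℕ) : ∑ a, pull π μ t a = 1 := by
  have h : ∑ a, ∫⁻ h, π.act t h {a} ∂law π μ t = 1 := by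
    rw [← lintegral_finsetSum _ fun a _ => measurable_act π t a]
    have : ∀ h, ∑ a, π.act t h {a} = 1 := fun h => by
      rw [sum_measure_singleton, Finset.coe_univ, measure_univ]
    simp [this]
  simp only [pull]
  rw [← ENNReal.toReal_sum fun a _ =>
    ((lintegral_act_le_one π μ t a).trans_lt ENNReal.one_lt_top).ne, h, ENNReal.toReal_one]

theorem pull_congr (π : Policy K) {μ μ' : Means K} {t : ℕ} (h : ∀ s < t, μ s = μ' s) (a : Fin K) :
    pull π μ t a = pull π μ' t a := by
  rw [pull, pull, law_congr π h]

theorem sq_pull_le (π : Policy K) {μ μ' : Means K} {t₀ : ℕ} {δ : ℝ}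
    (h : ∀ s < t₀, μ s = μ' s) (hδ : ∀ s a, |μ' s a - μ s a| ≤ δ) (i : ℕ) (a : Fin K) :
    pull π μ' (t₀ + i) a ^ 2 ≤ Real.exp (δ ^ 2 * i) * pull π μ (t₀ + i) a := by
  rw [← ENNReal.ofReal_le_ofReal_iff (by have := pull_nonneg π μ (t₀ + i) a; positivity),
    ENNReal.ofReal_pow (pull_nonneg ..), ENNReal.ofReal_mul (by positivity), ofReal_pull,
    ofReal_pull, mul_comm (δ ^ 2), Real.exp_nat_mul, ENNReal.ofReal_pow (by positivity)]
  refine (sq_lintegral_law_le π h hδ i _ (measurable_act π _ a)).trans ?_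
  refine mul_le_mul_right (lintegral_mono fun _ => ?_) _
  -- Values in [0, 1] turn the second moment into a probability.
  exact pow_le_of_le_one zero_le prob_le_one two_ne_zero

theorem regret_eq_sum (S : ℝ) (T : ℕ) (π : Policy K) (μ : Means K) :
    regret S T π μ =
      ENNReal.ofReal (∑ t ∈ Finset.range T, ∑ a, max 0 (S - μ t a) * pull π μ t a) := by
  induction T with
  | zero => simp [regret]
  | succ T ih =>
    have hm : ∀ t : ℕ, Measurable fun a : Fin K => ENNReal.ofReal (max 0 (S - μ t a)) :=
      fun t => measurable_of_countable _
    have hms : ∀ n, Measurable fun h : History K n =>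
        ∑ t : Fin n, ENNReal.ofReal (max 0 (S - μ t (h t).1)) := fun n =>
      Finset.measurable_sum _ fun t _ =>
        (hm t).comp (measurable_fst.comp (measurable_pi_apply t))
    have hnn : ∀ t, 0 ≤ ∑ a, max 0 (S - μ t a) * pull π μ t a := fun t =>
      Finset.sum_nonneg fun a _ => mul_nonneg (le_max_left _ _) (pull_nonneg ..)
    rw [Finset.sum_range_succ, ENNReal.ofReal_add (Finset.sum_nonneg fun t _ => hnn t) (hnn T),
      ← ih, regret, lintegral_law_succ π μ T (hms _)]
    have hstep : ∀ h : History K T, ∫⁻ p, ∑ t : Fin (T + 1), ENNReal.ofReal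
        (max 0 (S - μ t ((Fin.snoc h p : History K (T + 1)) t).1)) ∂stepKernel π μ T h =
        ∑ t : Fin T, ENNReal.ofReal (max 0 (S - μ t (h t).1)) +
          ∑ a, ENNReal.ofReal (max 0 (S - μ T a)) * π.act T h {a} := fun h => by
      simp only [Fin.sum_univ_castSucc, Fin.snoc_castSucc, Fin.snoc_last, Fin.val_castSucc,
        Fin.val_last]
      rw [lintegral_add_left measurable_const, lintegral_const, measure_univ, mul_one,
        lintegral_stepKernel (f := fun p => ENNReal.ofReal (max 0 (S - μ T p.1))) π μ T h
          ((hm T).comp measurable_fst)]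
      simp only [lintegral_const, measure_univ, mul_one, lintegral_fintype]
    rw [lintegral_congr hstep, lintegral_add_left (hms T), regret,
      lintegral_finsetSum _ fun a _ => (measurable_act π T a).const_mul _,
      ENNReal.ofReal_sum_of_nonneg fun a _ => mul_nonneg (le_max_left _ _) (pull_nonneg ..)]
    congr 1
    refine Finset.sum_congr rfl fun a _ => ?_
    rw [lintegral_const_mul _ (measurable_act π T a), ENNReal.ofReal_mul (le_max_left _ _),
      ofReal_pull]

end Law

/-! ### Swapping instances and the effect of one swap -/

/-- The two-armed instance in which arm `b t` has mean `S - Δ` in round `t`, and the other arm has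
mean `S + Δ`. -/
noncomputable def swapMeans (S Δ : ℝ) (b : ℕ → Fin 2) : Means 2 :=
  fun t a => if a = b t then S - Δ else S + Δ

/-- The sequence of arms `b`, with the two arms exchanged from round `t₀` on. -/
def flipFrom (t₀ : ℕ) (b : ℕ → Fin 2) : ℕ → Fin 2 :=
  fun t => if t₀ ≤ t then b t + 1 else b t

theorem flipFrom_of_le {t₀ t : ℕ} (h : t₀ ≤ t) (b : ℕ → Fin 2) : flipFrom t₀ b t = b t + 1 :=
  if_pos h

theorem flipFrom_of_lt {t₀ t : ℕ} (h : t < t₀) (b : ℕ → Fin 2) : flipFrom t₀ b t = b t :=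
  if_neg h.not_ge

/-- The probability that the bad arm is pulled in round `t`. -/
noncomputable def badProb (S Δ : ℝ) (π : Policy 2) (b : ℕ → Fin 2) (t : ℕ) : ℝ :=
  pull π (swapMeans S Δ b) t (b t)

theorem swapMeans_flipFrom_of_lt (S Δ : ℝ) {t₀ t : ℕ} (h : t < t₀) (b : ℕ → Fin 2) :
    swapMeans S Δ (flipFrom t₀ b) t = swapMeans S Δ b t := by
  unfold swapMeans
  rw [flipFrom_of_lt h]

theorem abs_swapMeans_sub_le (S : ℝ) {Δ : ℝ} (hΔ : 0 < Δ) (b b' : ℕ → Fin 2) (t : ℕ) (a : Fin 2) :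
    |swapMeans S Δ b' t a - swapMeans S Δ b t a| ≤ 2 * Δ := by
  simp only [swapMeans]
  split_ifs <;> rw [abs_le] <;> constructor <;> linarith

section Regret

variable (S : ℝ) {Δ : ℝ} (π : Policy 2) (b : ℕ → Fin 2)

theorem badProb_nonneg (t : ℕ) : 0 ≤ badProb S Δ π b t := pull_nonneg ..

theorem badProb_flipFrom_of_lt {t₀ t : ℕ} (h : t < t₀) :
    badProb S Δ π (flipFrom t₀ b) t = badProb S Δ π b t := by
  rw [badProb, badProb, flipFrom_of_lt h,
    pull_congr π fun s hs => swapMeans_flipFrom_of_lt S Δ (hs.trans h) b]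

theorem regret_swapMeans (hΔ : 0 < Δ) (T : ℕ) :
    regret S T π (swapMeans S Δ b) =
      ENNReal.ofReal (Δ * ∑ t ∈ Finset.range T, badProb S Δ π b t) := by
  rw [regret_eq_sum, Finset.mul_sum]
  congr 1
  refine Finset.sum_congr rfl fun t _ => ?_
  rw [Finset.sum_eq_single (b t)]
  · simp [swapMeans, badProb, hΔ.le]
  · intro a _ ha
    simp [swapMeans, ha, hΔ.le]
  · simp

/-- If `q` is the probability, after the swap, of the formerly bad arm, then `1 - q ≥ 3/4 - q²`
because `(q - 1/2)² ≥ 0`, and `q²` is controlled by the change of measure. -/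
theorem le_badProb_flipFrom (hΔ : 0 < Δ) (t₀ i : ℕ) :
    3 / 4 - Real.exp (4 * Δ ^ 2 * i) * badProb S Δ π b (t₀ + i) ≤
      badProb S Δ π (flipFrom t₀ b) (t₀ + i) := by
  have h1 := sq_pull_le π (fun s hs => (swapMeans_flipFrom_of_lt S Δ hs b).symm)
    (abs_swapMeans_sub_le S hΔ b (flipFrom t₀ b)) i (b (t₀ + i))
  have h2 := sum_pull π (swapMeans S Δ (flipFrom t₀ b)) (t₀ + i)
  have h3 : ∀ (c : Fin 2) (f : Fin 2 → ℝ), ∑ a, f a = f c + f (c + 1) := fun c f => by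
    rw [Fin.sum_univ_two]
    fin_cases c
    · rfl
    · exact add_comm _ _
  rw [h3 (b (t₀ + i))] at h2
  rw [badProb, badProb, flipFrom_of_le (Nat.le_add_right _ _)]
  have h4 : (2 * Δ) ^ 2 * i = 4 * Δ ^ 2 * i := by ring
  rw [h4] at h1
  nlinarith [sq_nonneg (pull π (swapMeans S Δ (flipFrom t₀ b)) (t₀ + i) (b (t₀ + i)) - 1 / 2)]

end Regret

/-! ### Placing one swap inside a block -/

theorem sum_range_shift_le {p : ℕ → ℝ} (hp : ∀ t, 0 ≤ p t) {j m n : ℕ} (h : j + m ≤ n) :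
    ∑ i ∈ Finset.range m, p (j + i) ≤ ∑ t ∈ Finset.range n, p t := by
  calc ∑ i ∈ Finset.range m, p (j + i)
      ≤ ∑ t ∈ Finset.range j, p t + ∑ i ∈ Finset.range m, p (j + i) :=
        le_add_of_nonneg_left (Finset.sum_nonneg fun t _ => hp t)
    _ = ∑ t ∈ Finset.range (j + m), p t := (Finset.sum_range_add p j m).symm
    _ ≤ _ := Finset.sum_le_sum_of_subset_of_nonneg (Finset.range_mono h) fun t _ _ => hp t

/-- Among the `n - m` windows of length `m` there is one whose sum is at most the average bound. -/
theorem exists_window_sum_le {p : ℕ → ℝ} (hp : ∀ t, 0 ≤ p t) {n m : ℕ} (hmn : m < n) {c : ℝ}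
    (h : ∑ t ∈ Finset.range n, p t ≤ (n - m) * c) :
    ∃ j < n - m, ∑ i ∈ Finset.range m, p (j + 1 + i) ≤ m * c := by
  have hne : (Finset.range (n - m)).Nonempty := by simpa [Nat.sub_eq_zero_iff_le] using hmn
  have hsum : ∑ j ∈ Finset.range (n - m), ∑ i ∈ Finset.range m, p (j + 1 + i) ≤
      ∑ j ∈ Finset.range (n - m), m * c := by
    rw [Finset.sum_comm]
    calc ∑ i ∈ Finset.range m, ∑ j ∈ Finset.range (n - m), p (j + 1 + i)
        ≤ ∑ i ∈ Finset.range m, ∑ t ∈ Finset.range n, p t := by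
          refine Finset.sum_le_sum fun i hi => ?_
          rw [Finset.mem_range] at hi
          refine (Finset.sum_congr rfl fun j _ => ?_).trans_le
            (sum_range_shift_le hp (j := 1 + i) (m := n - m) (by omega))
          congr 1
          omega
      _ ≤ m * ((n - m) * c) := by
          rw [Finset.sum_const, Finset.card_range, nsmul_eq_mul]
          gcongr
      _ = ∑ j ∈ Finset.range (n - m), m * c := by
          rw [Finset.sum_const, Finset.card_range, nsmul_eq_mul, Nat.cast_sub hmn.le]
          ring
  obtain ⟨j, hj, hle⟩ := Finset.exists_le_of_sum_le hne hsum
  exact ⟨j, Finset.mem_range.1 hj, hle⟩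

theorem log_le_sqrt {x : ℝ} (hx : 0 < x) : Real.log x ≤ √x := by
  have h1 := Real.log_le_sub_one_of_pos (show 0 < √x / 2 by positivity)
  rw [Real.log_div (by positivity) (by norm_num), Real.log_sqrt hx.le] at h1
  linarith [Real.log_two_lt_d9]

/-- In every window of `n` rounds after round `s` the arms can be exchanged so that the policy
pulls the bad arm often in the window. -/
theorem exists_flipFrom_le_sum_badProb (S : ℝ) {Δ : ℝ} (hΔ : 0 < Δ) (π : Policy 2)
    (b : ℕ → Fin 2) (s : ℕ) {n : ℕ} (hn : 4 ≤ n) (hx : 1 < Δ ^ 2 * n) :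
    ∃ t₀, s < t₀ ∧ t₀ ≤ s + n ∧ Real.log (Δ ^ 2 * n) / (16 * Δ ^ 2) ≤
      ∑ i ∈ Finset.range n, badProb S Δ π (flipFrom t₀ b) (s + i) := by
  have hlog := Real.log_pos hx
  set x := Δ ^ 2 * (n : ℝ) with hxdef
  have hx0 : 0 < x := by linarith
  have hnx : (n : ℝ) = x / Δ ^ 2 := by rw [hxdef]; field_simp
  rcases le_or_gt (Real.log x / (8 * Δ ^ 2)) (∑ i ∈ Finset.range n, badProb S Δ π b (s + i))
    with hbig | hsmall
  · refine ⟨s + n, by omega, le_rfl, ?_⟩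
    rw [Finset.sum_congr rfl fun i hi => badProb_flipFrom_of_lt S π b
      (Nat.add_lt_add_left (Finset.mem_range.1 hi) s)]
    refine le_trans ?_ hbig
    gcongr
    norm_num
  · set y := Real.log x / (8 * Δ ^ 2) with hy
    set m := ⌈y⌉₊ with hm
    have hy0 : 0 < y := by positivity
    have hym : y ≤ m := Nat.le_ceil y
    have hmy : (m : ℝ) < y + 1 := Nat.ceil_lt_add_one hy0.le
    have hΔy : 8 * Δ ^ 2 * y = Real.log x := by rw [hy]; field_simp
    have hyn : √x * y ≤ n / 8 := by
      rw [hy, hnx, ← mul_div_assoc, div_div, mul_comm (Δ ^ 2)]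
      gcongr
      nlinarith [log_le_sqrt hx0, Real.sq_sqrt hx0.le, Real.sqrt_nonneg x]
    have hsq : 1 ≤ √x := Real.one_le_sqrt.2 hx.le
    have h4 : (4 : ℝ) ≤ n := by exact_mod_cast hn
    have hmn : (m : ℝ) ≤ n / 2 := by nlinarith
    have hmn' : m < n := by
      have : (m : ℝ) < n := by linarith
      exact_mod_cast this
    -- This `c` makes the likelihood factor `√x` times the window sum at most `m / 4`. It is
    -- admissible since `4√x y ≤ n / 2 ≤ n - m`.
    obtain ⟨j, hj, hle⟩ := exists_window_sum_le (p := fun i => badProb S Δ π b (s + i))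
      (fun t => badProb_nonneg S π b _) hmn' (c := 1 / (4 * √x)) (by
        refine hsmall.le.trans ?_
        rw [mul_one_div, le_div_iff₀ (by positivity)]
        linarith)
    refine ⟨s + (j + 1), by omega, by omega, ?_⟩
    calc Real.log x / (16 * Δ ^ 2) = y / 2 := by rw [hy]; ring
      _ ≤ 3 / 4 * m - √x * (m * (1 / (4 * √x))) := by
        have : √x * (m * (1 / (4 * √x))) = m / 4 := by field_simp
        linarith
      _ ≤ 3 / 4 * m - √x * ∑ i ∈ Finset.range m, badProb S Δ π b (s + (j + 1 + i)) := by gcongr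
      _ = ∑ i ∈ Finset.range m, (3 / 4 - √x * badProb S Δ π b (s + (j + 1) + i)) := by
        rw [Finset.sum_sub_distrib, Finset.mul_sum, Finset.sum_const, Finset.card_range,
          nsmul_eq_mul, mul_comm (3 / 4 : ℝ)]
        simp only [add_assoc]
      _ ≤ ∑ i ∈ Finset.range m, badProb S Δ π (flipFrom (s + (j + 1)) b) (s + (j + 1) + i) := by
        refine Finset.sum_le_sum fun i hi => le_trans ?_ (le_badProb_flipFrom S π b hΔ _ i)
        have hi' : (i : ℝ) ≤ y := by
          have : (i : ℝ) + 1 ≤ m := by exact_mod_cast Finset.mem_range.1 hi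
          linarith
        -- As `m` is a ceiling, `i ≤ m - 1 < y`, and `4Δ² y = log x / 2`.
        have : Real.exp (4 * Δ ^ 2 * i) ≤ √x := by
          rw [Real.sqrt_eq_rpow, Real.rpow_def_of_pos hx0]
          refine Real.exp_le_exp.2 ?_
          nlinarith [sq_nonneg Δ]
        have := mul_le_mul_of_nonneg_right this (badProb_nonneg S (Δ := Δ) π b (s + (j + 1) + i))
        linarith
      _ ≤ _ := by
        simp only [add_assoc s]
        exact sum_range_shift_le (p := fun i => badProb S Δ π (flipFrom (s + (j + 1)) b) (s + i))
          (fun t => badProb_nonneg S π _ _) (by omega)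

/-! ### Chaining the blocks and counting segments -/

open Classical in
theorem card_filter_flipFrom {b : ℕ → Fin 2} {t₀ : ℕ} (h0 : 0 < t₀) (hb : b (t₀ - 1) = b t₀) {M : ℕ}
    (hM : t₀ ≤ M) :
    ((Finset.range M).filter fun j => flipFrom t₀ b j ≠ flipFrom t₀ b (j + 1)).card =
      ((Finset.range M).filter fun j => b j ≠ b (j + 1)).card + 1 := by
  have h1 : t₀ - 1 + 1 = t₀ := by omega
  rw [← Finset.card_insert_of_notMem (a := t₀ - 1) (by simp [h1, hb])]
  congr 1
  ext j
  simp only [Finset.mem_filter, Finset.mem_range, Finset.mem_insert]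
  rcases lt_trichotomy (j + 1) t₀ with h | h | h
  · rw [flipFrom_of_lt h, flipFrom_of_lt (by omega)]
    have : j ≠ t₀ - 1 := by omega
    tauto
  · obtain rfl : j = t₀ - 1 := by omega
    rw [flipFrom_of_lt (by omega), h1, flipFrom_of_le le_rfl, hb]
    have : ∀ c : Fin 2, c ≠ c + 1 := by decide
    simp only [this, ne_eq, not_false_eq_true, and_true, true_or, iff_true]
    omega
  · rw [flipFrom_of_le (by omega), flipFrom_of_le (by omega), (add_left_injective 1).ne_iff]
    have : j ≠ t₀ - 1 := by omega
    tauto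

open Classical in
-- Constancy of `b` from round `k * n` on is what makes the next swap create exactly one new change
-- point.
theorem exists_le_sum_badProb (S : ℝ) {Δ : ℝ} (hΔ : 0 < Δ) (π : Policy 2)
    {n : ℕ} (hn : 4 ≤ n) (hx : 1 < Δ ^ 2 * n) (k : ℕ) :
    ∃ b : ℕ → Fin 2, (∀ t, k * n ≤ t → b t = b (k * n)) ∧
      (∀ M, k * n ≤ M → ((Finset.range M).filter fun j => b j ≠ b (j + 1)).card = k) ∧
      k * (Real.log (Δ ^ 2 * n) / (16 * Δ ^ 2)) ≤
        ∑ t ∈ Finset.range (k * n), badProb S Δ π b t := by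
  induction k with
  | zero => exact ⟨fun _ => 0, by simp⟩
  | succ k ih =>
    obtain ⟨b, hb, hcard, hsum⟩ := ih
    obtain ⟨t₀, h1, h2, h3⟩ := exists_flipFrom_le_sum_badProb S hΔ π b (k * n) hn hx
    rw [add_one_mul k n]
    refine ⟨flipFrom t₀ b, fun t ht => ?_, fun M hM => ?_, ?_⟩
    · rw [flipFrom_of_le (h2.trans ht), flipFrom_of_le h2, hb t (by omega),
        hb (k * n + n) (by omega)]
    · rw [card_filter_flipFrom (by omega) (by rw [hb (t₀ - 1) (by omega), hb t₀ h1.le]) (h2.trans hM),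
        hcard M (by omega)]
    · rw [Finset.sum_range_add, Nat.cast_add_one, add_one_mul]
      refine add_le_add (hsum.trans_eq ?_) h3
      exact Finset.sum_congr rfl fun t ht =>
        (badProb_flipFrom_of_lt S π b ((Finset.mem_range.1 ht).trans h1)).symm

theorem swapMeans_mem_hardClass (S : ℝ) {Δ : ℝ} (hΔ : 0 < Δ) {b : ℕ → Fin 2} {T L : ℕ}
    (h : ((Finset.range (T - 1)).filter fun j => b j ≠ b (j + 1)).card + 1 = L) :
    swapMeans S Δ b ∈ hardClass S Δ T L := by
  refine ⟨fun t _ => ?_, ?_⟩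
  · rcases (show b t = 1 ∨ b t = 0 by generalize b t = c; revert c; decide) with hb | hb
    · left; ext a; fin_cases a <;> simp [swapMeans, hb]
    · right; ext a; fin_cases a <;> simp [swapMeans, hb]
  · rw [numSegments, add_comm, ← h]
    congr 1
    refine congrArg Finset.card (Finset.filter_congr fun j _ => ?_)
    constructor
    · rintro ⟨a, ha⟩ hj
      simp [swapMeans, hj] at ha
    · intro hj
      refine ⟨b j, ?_⟩
      simp only [swapMeans, if_true, if_neg hj]
      linarith

end SatisficingBandit

open SatisficingBandit in
theorem theorem2 :
    ∃ c : ℝ, 0 < c ∧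
      ∀ (S Δ : ℝ) (T L : ℕ), 0 < Δ → Δ ≤ 1 / 2 → 2 ≤ L → 13 * (L : ℝ) ≤ Δ ^ 2 * (T : ℝ) →
        ENNReal.ofReal (c * ((L : ℝ) * Real.log (Δ ^ 2 * (T : ℝ) / (L : ℝ)) / Δ)) ≤
          SatisficingBandit.minimaxRegret S Δ T L := by
  -- `1/64 = 1/16 · 1/2 · 1/2`: the block bound, `L - 1 ≥ L / 2`, and half of the logarithm lost by
  -- rounding `T / L` down.
  refine ⟨1 / 64, by norm_num, fun S Δ T L hΔ hΔ2 hL hT => le_iInf fun π => ?_⟩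
  have hL2 : (2 : ℝ) ≤ L := by exact_mod_cast hL
  have hL0 : (0 : ℝ) < L := by linarith
  set X := Δ ^ 2 * (T : ℝ) / L with hX
  have hX13 : 13 ≤ X := (le_div_iff₀ hL0).2 hT
  have hXL : X = Δ ^ 2 * (T / L) := by rw [hX, mul_div_assoc]
  have hsq : Δ ^ 2 ≤ 1 / 4 := by nlinarith
  have hTL : (52 : ℝ) ≤ T / L := by
    have : (0 : ℝ) ≤ T / L := by positivity
    nlinarith
  set n := T / L with hn
  have hnT : (T : ℝ) / L < n + 1 := by
    rw [div_lt_iff₀ hL0]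
    exact_mod_cast (Nat.lt_mul_div_succ T (show 0 < L by omega)).trans_eq (mul_comm _ _)
  have hn4 : 4 ≤ n := by
    have : (4 : ℝ) ≤ n := by linarith
    exact_mod_cast this
  have hxX : X / 2 ≤ Δ ^ 2 * n := by
    rw [hXL]
    nlinarith [sq_nonneg Δ]
  have hlog : Real.log X / 2 ≤ Real.log (Δ ^ 2 * n) := by
    refine le_trans ?_ (Real.log_le_log (by linarith) hxX)
    rw [Real.log_div (by linarith) two_ne_zero]
    have : Real.log (2 ^ 2) ≤ Real.log X := Real.log_le_log (by norm_num) (by linarith)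
    rw [Real.log_pow] at this
    push_cast at this
    linarith
  have hlogX : 0 ≤ Real.log X := Real.log_nonneg (by linarith)
  obtain ⟨b, -, hcard, hsum⟩ := exists_le_sum_badProb S hΔ π hn4 (by linarith) (L - 1)
  have hLn : L * n ≤ T := Nat.mul_div_le T L
  have hkn : (L - 1) * n + n = L * n := by
    rw [← add_one_mul, Nat.sub_add_cancel (by omega)]
  refine le_iSup₂_of_le (swapMeans S Δ b) (swapMeans_mem_hardClass S hΔ ?_) ?_
  -- The block left free gives `(L - 1) * n ≤ T - 1`, so even a swap at the end of the last used
  -- block falls inside the horizon.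
  · rw [← Nat.sub_add_cancel (show 1 ≤ L by omega), ← hcard (T - 1) (by omega)]
  · rw [regret_swapMeans S π b hΔ]
    refine ENNReal.ofReal_le_ofReal ?_
    calc 1 / 64 * (L * Real.log X / Δ)
        = Δ * (L / 2 * (Real.log X / 2 / (16 * Δ ^ 2))) := by field_simp; ring
      _ ≤ Δ * ((L - 1 : ℕ) * (Real.log (Δ ^ 2 * n) / (16 * Δ ^ 2))) := by
        gcongr
        rw [Nat.cast_sub (by omega), Nat.cast_one]
        linarith
      _ ≤ _ := by
        gcongr
        exact hsum.trans (Finset.sum_le_sum_of_subset_of_nonneg (Finset.range_mono (by omega))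
          fun t _ _ => badProb_nonneg S π b t)
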